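/- Let $N\in\{1,2\}$ and let $X$ be a compact metrizable space. Let $(\Phi(t))_{t\ge 0}$ be a continuous semiflow on $X$, that is, $\Phi(0)=\mathrm{id}$, $\Phi(t_1+t_2)=\Phi(t_1)\circ\Phi(t_2)$ for all $t_1,t_2\ge0$, and $(t,u)\mapsto\Phi(t)u$ is continuous on $[0,\infty)\times X$. Suppose that $(\Phi(t))_{t\ge0}$ is a bounded extended dissipative system on $\mathbb{R}^N$: to each $u\in X$ is associated a triple $(e,f,d)=(e_u,f_u,d_u)$ with $e,d\in C^0(\mathbb{R}^N,[0,\infty))$ and $f\in C^0(\mathbb{R}^N,\mathbb{R}^N)$ such that 1. $e,f,d$ depend continuously on $u\in X$, uniformly on compact subsets of $\mathbb{R}^N$; 2. there is a nondecreasing function $b:[0,\infty)\to[0,\infty)$, independent of $u$, such that $|f_u(x)|^2\le b(e_u(x))\,d_u(x)$ for all $u\in X$ and $x\in\mathbb{R}^N$; 3. if $d_u\equiv 0$, then $u$ is an equilibrium, i.e. $\Phi(t)u=u$ for all $t\ge0$; 4. along every trajectory $u(t)=\Phi(t)u_0$, the functions $e(x,t)=e_{u(t)}(x)$, $f(x,t)=f_{u(t)}(x)$,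 $d(x,t)=d_{u(t)}(x)$ satisfy $\partial_t e=\operatorname{div} f-d$ in the sense of distributions on $\mathbb{R}^N\times(0,\infty)$; 5. there is $E>0$ such that $e_u(x)\le E$ for all $u\in X$ and $x\in\mathbb{R}^N$. Put $\Psi_1(T)=\sqrt T$ and $\Psi_2(T)=\log T$. Given $u_0\in X$, let $u(t)=\Phi(t)u_0$ and let $$\bar\omega=\Bigl\{\bar u\in X \;\Big|\; \limsup_{T\to\infty}\frac{\Psi_N(T)}{T}\int_0^T \mathbf 1_{\mathcal V}(u(t))\,dt=\infty\ \text{ for all neighbourhoods }\mathcal V\text{ of }\bar u\Bigr\}.$$ Then $\bar\omega$ is nonempty, compact and contained in the set of equilibria. Moreover, for every neighbourhood $\mathcal V$ of $\bar\omega$ in $X$, $$\limsup_{T\to\infty}\frac{\Psi_N(T)}{T}\int_0^T \mathbf 1_{\mathcal V^c}(u(t))\,dt<\infty .$$ -/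

import Mathlib

open Filter Topology MeasureTheory Set
open scoped NNReal ENNReal ContDiff

namespace ExtDiss

/-- The space `ℝ^N` with its Euclidean norm. -/
abbrev Space (N : ℕ) : Type := EuclideanSpace ℝ (Fin N)

/-- The trajectory `u(t) = Φ(t) u₀` of a continuous semiflow `Φ` on `X`, as a function of a real
time `t`; only the values at `t ≥ 0` are meaningful. -/
def traj {X : Type*} [TopologicalSpace X] (Φ : Flow ℝ≥0 X) (u₀ : X) (t : ℝ) : X :=
  Φ t.toNNReal u₀

/-- The set of equilibria of a semiflow. -/
def equilibria {X : Type*} [TopologicalSpace X] (Φ : Flow ℝ≥0 X) : Set X :=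
  {v | ∀ t : ℝ≥0, Φ t v = v}

/-- The energy balance `∂ₜ e = div f - d` along the trajectory of `u₀`, in the sense of
distributions on `ℝ^N × (0, ∞)`. For a test function `φ(x, t)`, `fderiv ℝ φ (x, t) (0, 1)` is
`∂ₜ φ(x, t)` and `fderiv ℝ φ (x, t) (v, 0)` is `v · ∇φ(x, t)`. -/
def EnergyBalance {X : Type*} [TopologicalSpace X] {N : ℕ} (Φ : Flow ℝ≥0 X)
    (e : X → C(Space N, ℝ)) (f : X → C(Space N, Space N)) (d : X → C(Space N, ℝ))
    (u₀ : X) : Prop :=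
  ∀ φ : Space N × ℝ → ℝ, ContDiff ℝ ∞ φ → HasCompactSupport φ →
    tsupport φ ⊆ {p | 0 < p.2} →
    - ∫ t in Ioi (0 : ℝ), ∫ x : Space N,
        e (traj Φ u₀ t) x * fderiv ℝ φ (x, t) (0, 1)
      = (- ∫ t in Ioi (0 : ℝ), ∫ x : Space N,
          fderiv ℝ φ (x, t) (f (traj Φ u₀ t) x, 0))
        - ∫ t in Ioi (0 : ℝ), ∫ x : Space N, d (traj Φ u₀ t) x * φ (x, t)

/-- The continuous semiflow `Φ` on `X`, with the energy density `e`, the energy flux `f` and the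
energy dissipation rate `d`, is an extended dissipative system on `ℝ^N`. The spaces of continuous
functions carry the topology of uniform convergence on compact sets. -/
structure IsExtendedDissipative {X : Type*} [TopologicalSpace X] (N : ℕ) (Φ : Flow ℝ≥0 X)
    (e : X → C(Space N, ℝ)) (f : X → C(Space N, Space N)) (d : X → C(Space N, ℝ)) : Prop where
  e_nonneg : ∀ u x, 0 ≤ e u x
  d_nonneg : ∀ u x, 0 ≤ d u x
  continuous_e : Continuous e
  continuous_f : Continuous f
  continuous_d : Continuous d
  flux_bound : ∃ b : ℝ → ℝ, MonotoneOn b (Ici 0) ∧ (∀ s, 0 ≤ s → 0 ≤ b s) ∧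
    ∀ u x, ‖f u x‖ ^ 2 ≤ b (e u x) * d u x
  equilibrium_of_dissipation_eq_zero : ∀ u, (∀ x, d u x = 0) → u ∈ equilibria Φ
  energy_balance : ∀ u₀, EnergyBalance Φ e f d u₀

/-- The energy density is bounded, uniformly on `ℝ^N` and on the phase space. -/
def IsBoundedEnergy {X : Type*} {N : ℕ} (e : X → C(Space N, ℝ)) : Prop :=
  ∃ E : ℝ, 0 < E ∧ ∀ u x, e u x ≤ E

/-- `Ψ₁(T) = √T` and `Ψ₂(T) = log T` (only `N = 1, 2` are used). -/
noncomputable def Psi (N : ℕ) (T : ℝ) : ℝ :=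
  if N = 1 then Real.sqrt T else Real.log T

/-- `limsup_{T → ∞} (Ψ_N(T) / T) ∫_0^T 1_V(u(t)) dt`, as an element of `[0, ∞]`, where `u` is the
trajectory of `u₀`. -/
noncomputable def occupation {X : Type*} [TopologicalSpace X] (N : ℕ) (Φ : Flow ℝ≥0 X)
    (u₀ : X) (V : Set X) : ℝ≥0∞ :=
  limsup (fun T : ℝ => ENNReal.ofReal (Psi N T / T) *
    ∫⁻ t in Icc (0 : ℝ) T, V.indicator (fun _ => (1 : ℝ≥0∞)) (traj Φ u₀ t)) atTop

/-- The omega-limit set on average of the trajectory of `u₀`. -/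
def omegaBar {X : Type*} [TopologicalSpace X] (N : ℕ) (Φ : Flow ℝ≥0 X) (u₀ : X) : Set X :=
  {v | ∀ V ∈ 𝓝 v, occupation N Φ u₀ V = ⊤}

end ExtDiss

namespace ExtDiss

/-! Test the energy balance with `ψ(x)² θ(t)`, where `ψ = 1` on a fixed ball and `θ = 1` on `[2,
T]`. Since `|f|² ≤ b(E) d`, Young's inequality absorbs half of the dissipation produced by the flux
term (`localized_dissipation_le`), so the dissipation in the ball up to time `T` is at most a
constant times `∫ ψ² + T ∫ |∇ψ|²`. In dimensions one and two a ball can be cut off at arbitrarily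
small Dirichlet cost, and a `T`-dependent choice of `ψ` makes this bound `O(T / Ψ_N(T))`
(`exists_space_cutoff`).

A non-equilibrium dissipates at a definite rate in some ball, and so do all nearby states. By
Chebyshev, the time spent near it is `O(T / Ψ_N(T))` (`exists_isOpen_occupation_lt_top`), so
`omegaBar` contains only equilibria. The rest is compactness: finiteness of `occupation` passes to
finite unions of open sets, hence holds for compact sets avoiding `omegaBar`, while the whole space
has infinite occupation because `Ψ_N → ∞`. -/

theorem continuous_traj {X : Type*} [TopologicalSpace X] (Φ : Flow ℝ≥0 X) (u₀ : X) :
    Continuous (traj Φ u₀) :=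
  Φ.continuous continuous_real_toNNReal continuous_const

/-! ### Localized energy estimate. -/

theorem fderiv_sq_mul_apply {F : Type*} [NormedAddCommGroup F] [NormedSpace ℝ F]
    {ψ : F → ℝ} {θ : ℝ → ℝ} (hψ : ContDiff ℝ ∞ ψ) (hθ : ContDiff ℝ ∞ θ) (x : F) (t : ℝ)
    (v : F) (s : ℝ) :
    fderiv ℝ (fun p : F × ℝ => ψ p.1 ^ 2 * θ p.2) (x, t) (v, s) =
      2 * θ t * ψ x * fderiv ℝ ψ x v + ψ x ^ 2 * deriv θ t * s := by
  have h1 : HasFDerivAt ψ (fderiv ℝ ψ x) ((x, t) : F × ℝ).1 :=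
    (hψ.differentiable (by simp) x).hasFDerivAt
  have h2 : HasFDerivAt θ (fderiv ℝ θ t) ((x, t) : F × ℝ).2 :=
    (hθ.differentiable (by simp) t).hasFDerivAt
  have h3 := ((h1.comp (x, t) hasFDerivAt_fst).pow 2).mul (h2.comp (x, t) hasFDerivAt_snd)
  have h4 : HasFDerivAt (fun p : F × ℝ => ψ p.1 ^ 2 * θ p.2) _ (x, t) := h3
  rw [h4.fderiv]
  have h5 : fderiv ℝ θ t s = deriv θ t * s := by
    rw [fderiv_eq_smul_deriv, smul_eq_mul, mul_comm]
  simp [h5]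
  ring

theorem hasCompactSupport_prod_mul {F : Type*} [TopologicalSpace F] [R1Space F] {a : F → ℝ} {θ : ℝ → ℝ}
    (ha : HasCompactSupport a) (hθ : HasCompactSupport θ) {g : ℝ × F → ℝ}
    (hg : ∀ t x, a x = 0 ∨ θ t = 0 → g (t, x) = 0) : HasCompactSupport g := by
  refine HasCompactSupport.intro (K := tsupport θ ×ˢ tsupport a) (hθ.isCompact.prod ha.isCompact) ?_
  rintro ⟨t, x⟩ h
  rw [mem_prod, not_and_or] at h
  exact hg t x (h.symm.imp image_eq_zero_of_notMem_tsupport image_eq_zero_of_notMem_tsupport)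

/-- Localized energy estimate: testing the energy balance with `ψ(x)² θ(t)` and absorbing the flux
into the dissipation. -/
theorem localized_dissipation_le {X : Type*} [TopologicalSpace X] {N : ℕ} {Φ : Flow ℝ≥0 X}
    {e : X → C(Space N, ℝ)} {f : X → C(Space N, Space N)} {d : X → C(Space N, ℝ)}
    (he : Continuous e) (hf : Continuous f) (hd : Continuous d) {E B : ℝ}
    (he0 : ∀ u x, 0 ≤ e u x) (heE : ∀ u x, e u x ≤ E) (hd0 : ∀ u x, 0 ≤ d u x)
    (hfB : ∀ u x, ‖f u x‖ ^ 2 ≤ B * d u x) (hB : 0 ≤ B) {u₀ : X}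
    (hbal : EnergyBalance Φ e f d u₀)
    {ψ : Space N → ℝ} (hψ : ContDiff ℝ ∞ ψ) (hψc : HasCompactSupport ψ)
    {θ : ℝ → ℝ} (hθ : ContDiff ℝ ∞ θ) (hθc : HasCompactSupport θ) (hθs : tsupport θ ⊆ Ioi 0)
    (hθ0 : ∀ t, 0 ≤ θ t) :
    Integrable (fun t => θ t * ∫ x, ψ x ^ 2 * d (traj Φ u₀ t) x) (volume.restrict (Ioi 0)) ∧
    ∫ t in Ioi (0 : ℝ), θ t * ∫ x, ψ x ^ 2 * d (traj Φ u₀ t) x ≤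
      2 * E * (∫ t, |deriv θ t|) * (∫ x, ψ x ^ 2) +
      4 * B * (∫ t, θ t) * ∫ x, ‖fderiv ℝ ψ x‖ ^ 2 := by
  have hu := continuous_traj Φ u₀
  have hψ' : Continuous (fderiv ℝ ψ) := hψ.continuous_fderiv (by simp)
  have hθ' : Continuous (deriv θ) := hθ.continuous_deriv (by simp)
  have hψcont := hψ.continuous
  have hθcont := hθ.continuous
  have cce : Continuous fun p : ℝ × Space N => e (traj Φ u₀ p.1) p.2 := by
    have := (he.comp hu).comp (continuous_fst (X := ℝ) (Y := Space N))
    exact ContinuousEval.continuous_eval.comp (this.prodMk continuous_snd)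
  have ccf : Continuous fun p : ℝ × Space N => f (traj Φ u₀ p.1) p.2 := by
    have := (hf.comp hu).comp (continuous_fst (X := ℝ) (Y := Space N))
    exact ContinuousEval.continuous_eval.comp (this.prodMk continuous_snd)
  have ccd : Continuous fun p : ℝ × Space N => d (traj Φ u₀ p.1) p.2 := by
    have := (hd.comp hu).comp (continuous_fst (X := ℝ) (Y := Space N))
    exact ContinuousEval.continuous_eval.comp (this.prodMk continuous_snd)
  set μ := (volume.restrict (Ioi (0 : ℝ))).prod (volume : Measure (Space N)) with hμ
  have hint : ∀ g : ℝ × Space N → ℝ, Continuous g → HasCompactSupport g → Integrable g μ :=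
    fun g h1 h2 => h1.integrable_of_hasCompactSupport h2
  let F1 : ℝ × Space N → ℝ := fun p => e (traj Φ u₀ p.1) p.2 * (ψ p.2 ^ 2 * deriv θ p.1)
  let F2 : ℝ × Space N → ℝ :=
    fun p => 2 * θ p.1 * ψ p.2 * fderiv ℝ ψ p.2 (f (traj Φ u₀ p.1) p.2)
  let F3 : ℝ × Space N → ℝ := fun p => d (traj Φ u₀ p.1) p.2 * (ψ p.2 ^ 2 * θ p.1)
  let G1 : ℝ × Space N → ℝ := fun p => |deriv θ p.1| * ψ p.2 ^ 2
  let G2 : ℝ × Space N → ℝ := fun p => θ p.1 * ‖fderiv ℝ ψ p.2‖ ^ 2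
  have i1 : Integrable F1 μ := hint _ (by fun_prop)
    (hasCompactSupport_prod_mul hψc hθc.deriv (by rintro t x (h | h) <;> simp [F1, h]))
  have i2 : Integrable F2 μ := hint _ (by
      have : Continuous fun p : ℝ × Space N => fderiv ℝ ψ p.2 (f (traj Φ u₀ p.1) p.2) :=
        (hψ'.comp continuous_snd).clm_apply ccf
      fun_prop)
    (hasCompactSupport_prod_mul hψc hθc (by rintro t x (h | h) <;> simp [F2, h]))
  have i3 : Integrable F3 μ := hint _ (by fun_prop)
    (hasCompactSupport_prod_mul hψc hθc (by rintro t x (h | h) <;> simp [F3, h]))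
  have j1 : Integrable G1 μ := hint _ (by fun_prop)
    (hasCompactSupport_prod_mul hψc hθc.deriv (by rintro t x (h | h) <;> simp [G1, h]))
  have j2 : Integrable G2 μ := hint _ (by fun_prop)
    (hasCompactSupport_prod_mul (hψc.fderiv ℝ).norm hθc
      (by rintro t x (h | h) <;> simp [G2, h]))
  have hbal' : ∫ p, F3 p ∂μ = ∫ p, F1 p ∂μ - ∫ p, F2 p ∂μ := by
    have hcomp : HasCompactSupport fun p : Space N × ℝ => ψ p.1 ^ 2 * θ p.2 := by
      refine HasCompactSupport.intro (hψc.isCompact.prod hθc.isCompact) ?_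
      rintro ⟨x, t⟩ h
      rw [mem_prod, not_and_or] at h
      rcases h with h | h <;> simp [image_eq_zero_of_notMem_tsupport h]
    have hsupp : tsupport (fun p : Space N × ℝ => ψ p.1 ^ 2 * θ p.2) ⊆ {p | 0 < p.2} := by
      have hcl : IsClosed {p : Space N × ℝ | p.2 ∈ tsupport θ} :=
        (isClosed_tsupport θ).preimage continuous_snd
      refine (closure_minimal ?_ hcl).trans fun p hp => hθs hp
      intro p hp
      exact subset_tsupport _ (right_ne_zero_of_mul hp)
    have hsm : ContDiff ℝ ∞ fun p : Space N × ℝ => ψ p.1 ^ 2 * θ p.2 :=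
      ((hψ.comp contDiff_fst).pow 2).mul (hθ.comp contDiff_snd)
    have h := hbal _ hsm hcomp hsupp
    simp only [fderiv_sq_mul_apply hψ hθ, map_zero, mul_zero, mul_one, zero_add, add_zero] at h
    rw [integral_prod _ i1, integral_prod _ i2, integral_prod _ i3]
    simp only [F1, F2, F3]
    linarith
  have hF3eq : ∀ t, ∫ x, F3 (t, x) = θ t * ∫ x, ψ x ^ 2 * d (traj Φ u₀ t) x := by
    intro t
    rw [← integral_const_mul]
    congr 1; ext x; simp only [F3]; ring
  -- Young's inequality with weight `2⁻¹` on `F3`, so that half of the dissipation can be moved back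
  -- to the left-hand side.
  have hpt : ∀ p, F1 p - F2 p ≤ E * G1 p + 2⁻¹ * F3 p + 2 * B * G2 p := by
    rintro ⟨t, x⟩
    simp only [F1, F2, F3, G1, G2]
    set u := traj Φ u₀ t
    have a1 : e u x * (ψ x ^ 2 * deriv θ t) ≤ E * (|deriv θ t| * ψ x ^ 2) := by
      calc e u x * (ψ x ^ 2 * deriv θ t) ≤ e u x * (ψ x ^ 2 * |deriv θ t|) := by
            gcongr
            · exact he0 u x
            · exact le_abs_self _
        _ ≤ E * (ψ x ^ 2 * |deriv θ t|) := by gcongr; exact heE u x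
        _ = _ := by ring
    have a2 : (fderiv ℝ ψ x (f u x)) ^ 2 ≤ ‖fderiv ℝ ψ x‖ ^ 2 * (B * d u x) := by
      calc (fderiv ℝ ψ x (f u x)) ^ 2 = ‖fderiv ℝ ψ x (f u x)‖ ^ 2 := by simp
        _ ≤ (‖fderiv ℝ ψ x‖ * ‖f u x‖) ^ 2 := by gcongr; exact ContinuousLinearMap.le_opNorm _ _
        _ ≤ _ := by rw [mul_pow]; gcongr; exact hfB u x
    have a3 : -(2 * ψ x * fderiv ℝ ψ x (f u x)) ≤
        2⁻¹ * (d u x * ψ x ^ 2) + 2 * B * ‖fderiv ℝ ψ x‖ ^ 2 := by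
      set L := fderiv ℝ ψ x (f u x)
      set n := ‖fderiv ℝ ψ x‖ ^ 2 with hn
      have hn0 : 0 ≤ n := by positivity
      have hd1 := hd0 u x
      have hrhs : 0 ≤ 2⁻¹ * (d u x * ψ x ^ 2) + 2 * B * n := by positivity
      -- After squaring, `a2` bounds the left side by `4ab` with `a = 2⁻¹ d ψ²` and `b = 2 B n`, and
      -- `4ab ≤ (a + b)²`.
      refine (abs_le_of_sq_le_sq' ?_ hrhs).2
      nlinarith [sq_nonneg (2⁻¹ * (d u x * ψ x ^ 2) - 2 * B * n),
        mul_le_mul_of_nonneg_left a2 (sq_nonneg (ψ x))]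
    have := mul_le_mul_of_nonneg_left a3 (hθ0 t)
    nlinarith
  have hle : ∫ p, F1 p ∂μ - ∫ p, F2 p ∂μ ≤
      E * (∫ p, G1 p ∂μ) + 2⁻¹ * (∫ p, F3 p ∂μ) + 2 * B * ∫ p, G2 p ∂μ := by
    have k : Integrable (fun p => E * G1 p + 2⁻¹ * F3 p) μ :=
      (j1.const_mul _).add (i3.const_mul _)
    rw [← integral_sub i1 i2, ← integral_const_mul, ← integral_const_mul, ← integral_const_mul,
      ← integral_add (j1.const_mul _) (i3.const_mul _), ← integral_add k (j2.const_mul _)]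
    exact integral_mono (i1.sub i2) (k.add (j2.const_mul _)) hpt
  have hG1 : ∫ p, G1 p ∂μ ≤ (∫ t, |deriv θ t|) * ∫ x, ψ x ^ 2 := by
    simp only [G1, hμ]
    rw [integral_prod_mul (fun t => |deriv θ t|) (fun x => ψ x ^ 2)]
    refine mul_le_mul_of_nonneg_right ?_ (integral_nonneg fun x => sq_nonneg _)
    exact setIntegral_le_integral
      (hθ'.abs.integrable_of_hasCompactSupport hθc.deriv.norm)
      (Eventually.of_forall fun t => abs_nonneg _)
  have hG2 : ∫ p, G2 p ∂μ ≤ (∫ t, θ t) * ∫ x, ‖fderiv ℝ ψ x‖ ^ 2 := by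
    simp only [G2, hμ]
    rw [integral_prod_mul θ (fun x => ‖fderiv ℝ ψ x‖ ^ 2)]
    refine mul_le_mul_of_nonneg_right ?_ (integral_nonneg fun x => sq_nonneg _)
    exact setIntegral_le_integral (hθcont.integrable_of_hasCompactSupport hθc)
      (Eventually.of_forall hθ0)
  have hE : 0 ≤ E := (he0 u₀ 0).trans (heE u₀ 0)
  refine ⟨?_, ?_⟩
  · have := i3.integral_prod_left
    simpa only [hF3eq] using this
  · have h3 := integral_prod _ i3
    simp only [hF3eq] at h3
    rw [← h3]
    have k1 := mul_le_mul_of_nonneg_left hG1 hE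
    have k2 := mul_le_mul_of_nonneg_left hG2 (by positivity : 0 ≤ 2 * B)
    linarith

/-! ### Time cutoffs. -/

theorem hasCompactSupport_deriv_smoothTransition :
    HasCompactSupport (deriv Real.smoothTransition) := by
  refine HasCompactSupport.intro (isCompact_Icc (a := (0 : ℝ)) (b := 1)) fun t ht => ?_
  rw [mem_Icc, not_and_or, not_le, not_le] at ht
  rcases ht with ht | ht
  · have : Real.smoothTransition =ᶠ[𝓝 t] fun _ => 0 :=
      (eventually_lt_nhds ht).mono fun s hs => Real.smoothTransition.zero_of_nonpos hs.le
    simp [this.deriv_eq]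
  · have : Real.smoothTransition =ᶠ[𝓝 t] fun _ => 1 :=
      (eventually_gt_nhds ht).mono fun s hs => Real.smoothTransition.one_of_one_le hs.le
    simp [this.deriv_eq]

/-- Smooth time cutoffs, equal to one on `[2, T]`, of total variation bounded independently
of `T`. -/
theorem exists_time_cutoff : ∃ M : ℝ, 0 ≤ M ∧ ∀ T : ℝ, 0 ≤ T → ∃ θ : ℝ → ℝ,
    ContDiff ℝ ∞ θ ∧ HasCompactSupport θ ∧ tsupport θ ⊆ Ioi 0 ∧ (∀ t, 0 ≤ θ t) ∧
    (∀ t ∈ Icc 2 T, θ t = 1) ∧ ∫ t, |deriv θ t| ≤ M ∧ ∫ t, θ t ≤ T + 1 := by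
  set S := Real.smoothTransition
  have hS : ContDiff ℝ ∞ S := Real.smoothTransition.contDiff
  have hSd : Differentiable ℝ S := hS.differentiable (by simp)
  have hint : Integrable fun t => |deriv S t| :=
    (hS.continuous_deriv (by simp)).abs.integrable_of_hasCompactSupport
      hasCompactSupport_deriv_smoothTransition.norm
  refine ⟨2 * ∫ t, |deriv S t|, by positivity, fun T hT => ?_⟩
  -- A rise on `[1, 2]` minus its translate on `[T + 1, T + 2]`: the variation is at most twice that
  -- of `S`, whatever `T` is. Starting at `1` keeps the support away from `t = 0`.
  let θ : ℝ → ℝ := fun t => S (t - 1) - S (t - (1 + T))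
  have hθ : ContDiff ℝ ∞ θ :=
    (hS.comp (contDiff_id.sub contDiff_const)).sub (hS.comp (contDiff_id.sub contDiff_const))
  have hz : ∀ t, t ∉ Icc 1 (T + 2) → θ t = 0 := by
    intro t ht
    rw [mem_Icc, not_and_or, not_le, not_le] at ht
    rcases ht with ht | ht
    · simp only [θ, S]
      rw [Real.smoothTransition.zero_of_nonpos (by linarith),
        Real.smoothTransition.zero_of_nonpos (by linarith), sub_zero]
    · simp only [θ, S]
      rw [Real.smoothTransition.one_of_one_le (by linarith),
        Real.smoothTransition.one_of_one_le (by linarith), sub_self]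
  have hθc : HasCompactSupport θ := HasCompactSupport.intro isCompact_Icc fun t => hz t
  have h1 : ∀ t, θ t ≤ 1 := fun t => by
    have := Real.smoothTransition.le_one (t - 1)
    have := Real.smoothTransition.nonneg (t - (1 + T))
    simp only [θ, S]; linarith
  refine ⟨θ, hθ, hθc, ?_, ?_, ?_, ?_, ?_⟩
  · refine (closure_minimal (fun t ht => ?_) isClosed_Icc : tsupport θ ⊆ Icc 1 (T + 2)).trans
      fun t ht => lt_of_lt_of_le one_pos ht.1
    by_contra h
    exact ht (hz t h)
  · intro t
    exact sub_nonneg.2 (Real.smoothTransition.monotone (by linarith))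
  · intro t ht
    simp only [θ, S]
    rw [Real.smoothTransition.one_of_one_le (by linarith [ht.1]),
      Real.smoothTransition.zero_of_nonpos (by linarith [ht.2]), sub_zero]
  · have hd : ∀ t, deriv θ t = deriv S (t - 1) - deriv S (t - (1 + T)) := by
      intro t
      have a := ((hSd (t - 1)).hasDerivAt).comp_sub_const t 1
      have b := ((hSd (t - (1 + T))).hasDerivAt).comp_sub_const t (1 + T)
      exact (a.sub b).deriv
    calc ∫ t, |deriv θ t| ≤ ∫ t, (|deriv S (t - 1)| + |deriv S (t - (1 + T))|) := by
          refine integral_mono ?_ ((hint.comp_sub_right 1).add (hint.comp_sub_right (1 + T))) ?_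
          · exact (hθ.continuous_deriv (by simp)).abs.integrable_of_hasCompactSupport
              hθc.deriv.norm
          · intro t
            simp only [hd]
            exact abs_sub _ _
      _ = 2 * ∫ t, |deriv S t| := by
          rw [integral_add (hint.comp_sub_right 1) (hint.comp_sub_right (1 + T)),
            integral_sub_right_eq_self (fun t => |deriv S t|),
            integral_sub_right_eq_self (fun t => |deriv S t|)]
          ring
  · calc ∫ t, θ t = ∫ t in Icc 1 (T + 2), θ t :=
          (setIntegral_eq_integral_of_forall_compl_eq_zero fun t => hz t).symm
      _ ≤ ∫ t in Icc 1 (T + 2), (1 : ℝ) :=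
          setIntegral_mono (hθ.continuous.integrable_of_hasCompactSupport hθc).integrableOn
            (by simp) h1
      _ = T + 1 := by simp; rw [max_eq_left (by linarith)]; ring

/-! ### Space cutoffs with small Dirichlet energy. -/

theorem norm_sum_sq_le_of_disjoint {ι : Type*} {F : Type*} [NormedAddCommGroup F]
    (s : Finset ι) (L : ι → F)
    (h : ∀ i ∈ s, ∀ j ∈ s, i ≠ j → L i = 0 ∨ L j = 0) :
    ‖∑ i ∈ s, L i‖ ^ 2 ≤ ∑ i ∈ s, ‖L i‖ ^ 2 := by
  by_cases h0 : ∃ i ∈ s, L i ≠ 0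
  · obtain ⟨i, hi, hLi⟩ := h0
    rw [Finset.sum_eq_single_of_mem i hi fun j hj hji => (h j hj i hi hji).resolve_right hLi]
    exact Finset.single_le_sum (f := fun i => ‖L i‖ ^ 2) (fun j _ => sq_nonneg _) hi
  · push Not at h0
    rw [Finset.sum_eq_zero h0]
    simpa using Finset.sum_nonneg fun i _ => sq_nonneg ‖L i‖

section Scaling

variable {F : Type*} [NormedAddCommGroup F] [NormedSpace ℝ F]

theorem fderiv_comp_inv_smul {χ : F → ℝ} (hχ : Differentiable ℝ χ) (r : ℝ) (x : F) :
    fderiv ℝ (fun y => χ (r⁻¹ • y)) x = r⁻¹ • fderiv ℝ χ (r⁻¹ • x) := by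
  have h := (hχ (r⁻¹ • x)).hasFDerivAt.comp x ((hasFDerivAt_id x).const_smul r⁻¹)
  have h' : HasFDerivAt (fun y => χ (r⁻¹ • y)) _ x := h
  rw [h'.fderiv]
  ext v; simp

variable [FiniteDimensional ℝ F] [MeasurableSpace F] [BorelSpace F] (μ : Measure F)
  [μ.IsAddHaarMeasure]

theorem integral_sq_comp_inv_smul (χ : F → ℝ) {r : ℝ} (hr : 0 ≤ r) :
    ∫ x, χ (r⁻¹ • x) ^ 2 ∂μ = r ^ Module.finrank ℝ F * ∫ x, χ x ^ 2 ∂μ := by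
  simpa using μ.integral_comp_inv_smul_of_nonneg (fun x => χ x ^ 2) hr

/-- The Dirichlet energy scales like `r ^ (N - 2)`: dilation alone makes it small when `N = 1`, but
leaves it invariant when `N = 2`, where many scales have to be averaged. -/
theorem integral_sq_norm_fderiv_comp_inv_smul {χ : F → ℝ} (hχ : Differentiable ℝ χ) {r : ℝ}
    (hr : 0 ≤ r) :
    ∫ x, ‖fderiv ℝ (fun y => χ (r⁻¹ • y)) x‖ ^ 2 ∂μ =
      r ^ Module.finrank ℝ F * (r⁻¹ ^ 2 * ∫ x, ‖fderiv ℝ χ x‖ ^ 2 ∂μ) := by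
  simp only [fderiv_comp_inv_smul hχ, norm_smul, mul_pow, norm_inv, Real.norm_of_nonneg hr]
  rw [integral_const_mul]
  rw [μ.integral_comp_inv_smul_of_nonneg (fun x => ‖fderiv ℝ χ x‖ ^ 2) hr, smul_eq_mul]
  ring

end Scaling

theorem integrable_sq_of_hasCompactSupport {F : Type*} [TopologicalSpace F] [MeasurableSpace F]
    [OpensMeasurableSpace F] (μ : Measure F) [IsFiniteMeasureOnCompacts μ] {g : F → ℝ}
    (hg : Continuous g) (hgc : HasCompactSupport g) : Integrable (fun x => g x ^ 2) μ := by
  have h : HasCompactSupport fun x => g x ^ 2 := by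
    simp only [sq]
    exact hgc.mul_left
  exact (hg.pow 2).integrable_of_hasCompactSupport h

/-- The outer radius is below `2 * R`, so that the gradients of dyadic rescalings live in disjoint
annuli. -/
theorem exists_bump {F : Type*} [NormedAddCommGroup F] [NormedSpace ℝ F] [FiniteDimensional ℝ F]
    [HasContDiffBump F] {R : ℝ} (hR : 0 < R) : ∃ χ : F → ℝ, ContDiff ℝ ∞ χ ∧ HasCompactSupport χ ∧
      (∀ x ∈ Metric.closedBall 0 R, χ x = 1) ∧ tsupport χ ⊆ Metric.closedBall 0 (3 / 2 * R) := by
  let χ : ContDiffBump (0 : F) := ⟨R, 3 / 2 * R, hR, by linarith⟩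
  exact ⟨χ, χ.contDiff, χ.hasCompactSupport, fun x hx => χ.one_of_mem_closedBall hx,
    χ.tsupport_eq.le⟩

/-- Smooth cutoffs of `ℝ²` with small Dirichlet energy: the average of `K` dyadic rescalings of a
bump function, whose gradients have disjoint supports. -/
theorem exists_log_cutoff {R : ℝ} (hR : 0 < R) : ∃ A G : ℝ, 0 ≤ A ∧ 0 ≤ G ∧
    ∀ K : ℕ, 0 < K → ∃ ψ : Space 2 → ℝ, ContDiff ℝ ∞ ψ ∧ HasCompactSupport ψ ∧
      (∀ x ∈ Metric.closedBall 0 R, ψ x = 1) ∧ ∫ x, ψ x ^ 2 ≤ A * 4 ^ K ∧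
      ∫ x, ‖fderiv ℝ ψ x‖ ^ 2 ≤ G / K := by
  obtain ⟨χ, hχ, hχc, hχ1, hχs⟩ := exists_bump (F := Space 2) hR
  have hχd : Differentiable ℝ χ := hχ.differentiable (by simp)
  refine ⟨∫ x, χ x ^ 2, ∫ x, ‖fderiv ℝ χ x‖ ^ 2, integral_nonneg fun x => sq_nonneg _,
    integral_nonneg fun x => sq_nonneg _, fun K hK => ?_⟩
  have hK' : (0 : ℝ) < K := by exact_mod_cast hK
  let η : ℕ → Space 2 → ℝ := fun k x => χ (((2 : ℝ) ^ k)⁻¹ • x)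
  have hη : ∀ k, ContDiff ℝ ∞ (η k) := fun k => hχ.comp (contDiff_const_smul _)
  have hηd : ∀ k, Differentiable ℝ (η k) := fun k => (hη k).differentiable (by simp)
  have hηc : ∀ k, HasCompactSupport (η k) := fun k =>
    hχc.comp_smul (by positivity)
  let ψ : Space 2 → ℝ := fun x => (K : ℝ)⁻¹ * ∑ k ∈ Finset.range K, η k x
  have hψ : ContDiff ℝ ∞ ψ := contDiff_const.mul (ContDiff.sum fun k _ => hη k)
  have hψz : ∀ x, x ∉ ⋃ k ∈ Finset.range K, tsupport (η k) → ψ x = 0 := by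
    intro x hx
    simp only [mem_iUnion, not_exists] at hx
    simp only [ψ]
    rw [Finset.sum_eq_zero fun k hk => image_eq_zero_of_notMem_tsupport (hx k hk), mul_zero]
  have hψc : HasCompactSupport ψ := HasCompactSupport.intro
    ((Finset.range K).isCompact_biUnion fun k _ => (hηc k).isCompact) hψz
  have iη : ∀ k, Integrable fun x => η k x ^ 2 := fun k =>
    integrable_sq_of_hasCompactSupport volume (hη k).continuous (hηc k)
  have iη' : ∀ k, Integrable fun x => ‖fderiv ℝ (η k) x‖ ^ 2 := fun k =>
    integrable_sq_of_hasCompactSupport volume ((hη k).continuous_fderiv (by simp)).norm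
      ((hηc k).fderiv ℝ).norm
  have hfd : ∀ x, fderiv ℝ ψ x = (K : ℝ)⁻¹ • ∑ k ∈ Finset.range K, fderiv ℝ (η k) x := by
    intro x
    have h1 : HasFDerivAt (fun x => ∑ k ∈ Finset.range K, η k x)
        (∑ k ∈ Finset.range K, fderiv ℝ (η k) x) x :=
      HasFDerivAt.fun_sum fun k _ => (hηd k x).hasFDerivAt
    exact (h1.const_mul _).fderiv
  have hann : ∀ k x, fderiv ℝ (η k) x ≠ 0 → 2 ^ k * R ≤ ‖x‖ ∧ ‖x‖ ≤ 2 ^ k * (3 / 2 * R) := by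
    intro k x hx
    have h2 : (0 : ℝ) < 2 ^ k := by positivity
    have hn : ‖((2 : ℝ) ^ k)⁻¹ • x‖ = ‖x‖ / 2 ^ k := by
      rw [norm_smul, norm_inv, Real.norm_of_nonneg h2.le]; ring
    rw [fderiv_comp_inv_smul hχd] at hx
    have hx' := (smul_ne_zero_iff.1 hx).2
    constructor
    · by_contra! hlt
      refine hx' ?_
      have hmem : ((2 : ℝ) ^ k)⁻¹ • x ∈ Metric.ball 0 R := by
        rw [mem_ball_zero_iff, hn, div_lt_iff₀ h2]
        linarith
      have : χ =ᶠ[𝓝 (((2 : ℝ) ^ k)⁻¹ • x)] fun _ => 1 := by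
        filter_upwards [Metric.isOpen_ball.mem_nhds hmem] with y hy
        exact hχ1 y (Metric.ball_subset_closedBall hy)
      rw [this.fderiv_eq]; simp
    · have := hχs (support_fderiv_subset (𝕜 := ℝ) hx')
      rw [mem_closedBall_zero_iff, hn, div_le_iff₀ h2] at this
      linarith
  have hdis : ∀ x, ∀ i j : ℕ, i < j → fderiv ℝ (η i) x = 0 ∨ fderiv ℝ (η j) x = 0 := by
    intro x i j hij
    by_contra! h
    have h1 := (hann i x h.1).2
    have h2 := (hann j x h.2).1
    have h3 : (2 : ℝ) ^ (i + 1) ≤ 2 ^ j := pow_le_pow_right₀ (by norm_num) hij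
    have h4 : (0 : ℝ) < 2 ^ i := by positivity
    rw [pow_succ] at h3
    nlinarith [mul_le_mul_of_nonneg_right h3 hR.le, mul_pos h4 hR]
  refine ⟨ψ, hψ, hψc, ?_, ?_, ?_⟩
  · intro x hx
    have : ∀ k ∈ Finset.range K, η k x = 1 := by
      intro k _
      refine hχ1 _ ?_
      have h2 : (1 : ℝ) ≤ 2 ^ k := one_le_pow₀ (by norm_num)
      rw [mem_closedBall_zero_iff] at hx ⊢
      rw [norm_smul, norm_inv, Real.norm_of_nonneg (by positivity)]
      exact (mul_le_of_le_one_left (norm_nonneg _) (inv_le_one_of_one_le₀ h2)).trans hx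
    simp only [ψ]
    rw [Finset.sum_congr rfl this]
    simp [hK'.ne']
  -- Cauchy–Schwarz over the `K` scales.
  · have hpt : ∀ x, ψ x ^ 2 ≤ (K : ℝ)⁻¹ * ∑ k ∈ Finset.range K, η k x ^ 2 := by
      intro x
      have := sq_sum_le_card_mul_sum_sq (s := Finset.range K) (f := fun k => η k x)
      rw [Finset.card_range] at this
      calc ψ x ^ 2 = (K : ℝ)⁻¹ ^ 2 * (∑ k ∈ Finset.range K, η k x) ^ 2 := mul_pow _ _ _
        _ ≤ (K : ℝ)⁻¹ ^ 2 * (K * ∑ k ∈ Finset.range K, η k x ^ 2) := by gcongr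
        _ = _ := by field_simp
    calc ∫ x, ψ x ^ 2 ≤ ∫ x, (K : ℝ)⁻¹ * ∑ k ∈ Finset.range K, η k x ^ 2 :=
          integral_mono (integrable_sq_of_hasCompactSupport volume hψ.continuous hψc)
            ((integrable_finsetSum _ fun k _ => iη k).const_mul _) hpt
      _ = (K : ℝ)⁻¹ * ∑ k ∈ Finset.range K, 4 ^ k * ∫ x, χ x ^ 2 := by
          rw [integral_const_mul, integral_finsetSum _ fun k _ => iη k]
          congr 1
          refine Finset.sum_congr rfl fun k _ => ?_
          rw [integral_sq_comp_inv_smul volume χ (by positivity : (0 : ℝ) ≤ 2 ^ k)]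
          simp only [finrank_euclideanSpace, Fintype.card_fin, ← pow_mul, mul_comm k 2]
          simp only [pow_mul]; norm_num
      _ ≤ (K : ℝ)⁻¹ * ∑ k ∈ Finset.range K, 4 ^ K * ∫ x, χ x ^ 2 := by
          gcongr with k hk
          · norm_num
          · exact (Finset.mem_range.1 hk).le
      _ = _ := by simp; field_simp
  · have hpt : ∀ x, ‖fderiv ℝ ψ x‖ ^ 2 ≤
        (K : ℝ)⁻¹ ^ 2 * ∑ k ∈ Finset.range K, ‖fderiv ℝ (η k) x‖ ^ 2 := by
      intro x
      rw [hfd, norm_smul, mul_pow, norm_inv, Real.norm_of_nonneg hK'.le]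
      gcongr
      -- At each point at most one gradient is nonzero, so no factor `K` is lost here: `K` equal
      -- energies times `K⁻²` give the decay `1 / K`.
      refine norm_sum_sq_le_of_disjoint _ _ fun i _ j _ hij => ?_
      rcases hij.lt_or_gt with h | h
      · exact hdis x i j h
      · exact (hdis x j i h).symm
    calc ∫ x, ‖fderiv ℝ ψ x‖ ^ 2
        ≤ ∫ x, (K : ℝ)⁻¹ ^ 2 * ∑ k ∈ Finset.range K, ‖fderiv ℝ (η k) x‖ ^ 2 :=
          integral_mono
            (integrable_sq_of_hasCompactSupport volume (hψ.continuous_fderiv (by simp)).norm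
              (hψc.fderiv ℝ).norm)
            ((integrable_finsetSum _ fun k _ => iη' k).const_mul _) hpt
      _ = (K : ℝ)⁻¹ ^ 2 * ∑ k ∈ Finset.range K, ∫ x, ‖fderiv ℝ χ x‖ ^ 2 := by
          rw [integral_const_mul, integral_finsetSum _ fun k _ => iη' k]
          congr 1
          refine Finset.sum_congr rfl fun k _ => ?_
          rw [integral_sq_norm_fderiv_comp_inv_smul volume hχd
            (by positivity : (0 : ℝ) ≤ 2 ^ k)]
          simp only [finrank_euclideanSpace, Fintype.card_fin]
          -- Scale invariance in dimension two: `(2 ^ k)²` from the volume cancels the two inverse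
          -- powers from the gradient.
          rw [← mul_assoc, ← mul_pow, mul_inv_cancel₀ (by positivity)]; simp
      _ = _ := by simp; field_simp

/-- Space cutoffs adapted to the rate `Ψ_N`. -/
theorem exists_space_cutoff {N : ℕ} (hN : 1 ≤ N) (hN' : N ≤ 2) {R : ℝ} (hR : 0 < R) :
    ∃ C : ℝ, 0 ≤ C ∧ ∀ T : ℝ, 2 ≤ T → ∃ ψ : Space N → ℝ,
      ContDiff ℝ ∞ ψ ∧ HasCompactSupport ψ ∧ (∀ x ∈ Metric.closedBall 0 R, ψ x = 1) ∧
      Psi N T * (∫ x, ψ x ^ 2) ≤ C * T ∧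
      Psi N T * ∫ x, ‖fderiv ℝ ψ x‖ ^ 2 ≤ C := by
  obtain rfl | rfl : N = 1 ∨ N = 2 := by omega
  · obtain ⟨χ, hχ, hχc, hχ1, -⟩ := exists_bump (F := Space 1) hR
    have hχd : Differentiable ℝ χ := hχ.differentiable (by simp)
    set A := ∫ x, χ x ^ 2
    set G := ∫ x, ‖fderiv ℝ χ x‖ ^ 2
    have hA : 0 ≤ A := integral_nonneg fun x => sq_nonneg _
    have hG : 0 ≤ G := integral_nonneg fun x => sq_nonneg _
    refine ⟨A + G, by positivity, fun T hT => ?_⟩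
    have hT0 : 0 < √T := Real.sqrt_pos.2 (by linarith)
    have hT1 : 1 ≤ √T := Real.one_le_sqrt.2 (by linarith)
    have hTT : √T * √T = T := Real.mul_self_sqrt (by linarith)
    -- The diffusive length `√T` balances `∫ ψ² ~ √T` against `T ∫ |∇ψ|² ~ √T`.
    refine ⟨fun x => χ ((√T)⁻¹ • x), hχ.comp (contDiff_const_smul _),
      hχc.comp_smul (by positivity), ?_, ?_, ?_⟩
    · intro x hx
      refine hχ1 _ ?_
      rw [mem_closedBall_zero_iff] at hx ⊢
      rw [norm_smul, norm_inv, Real.norm_of_nonneg hT0.le]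
      exact (mul_le_of_le_one_left (norm_nonneg _) (inv_le_one_of_one_le₀ hT1)).trans hx
    · rw [integral_sq_comp_inv_smul volume χ hT0.le]
      simp only [Psi, if_true, finrank_euclideanSpace, Fintype.card_fin, pow_one]
      rw [← mul_assoc, hTT]
      nlinarith [mul_nonneg hG (by linarith : 0 ≤ T)]
    · rw [integral_sq_norm_fderiv_comp_inv_smul volume hχd hT0.le]
      simp only [Psi, if_true, finrank_euclideanSpace, Fintype.card_fin, pow_one]
      have : √T * (√T * ((√T)⁻¹ ^ 2 * G)) = G := by field_simp
      linarith
  · obtain ⟨A, G, hA, hG, h⟩ := exists_log_cutoff hR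
    refine ⟨8 * A + 4 * G, by positivity, fun T hT => ?_⟩
    have hT0 : 0 < T := by linarith
    have hlog : 0 < Real.log T := Real.log_pos (by linarith)
    have hK : 0 < ⌈Real.log T / 4⌉₊ := Nat.ceil_pos.2 (by positivity)
    -- About `log T / 4` scales: enough for `G / K ≤ 4 G / log T`, yet few enough that `4 ^ K ≤ 4
    -- √T`, which leaves a factor `√T` to absorb `log T`.
    set K := ⌈Real.log T / 4⌉₊
    have hK1 : Real.log T / 4 ≤ K := Nat.le_ceil _
    have hK2 : (K : ℝ) < Real.log T / 4 + 1 := Nat.ceil_lt_add_one (by positivity)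
    have hsq : 0 < √T := Real.sqrt_pos.2 hT0
    have hTT : √T * √T = T := Real.mul_self_sqrt hT0.le
    have h4 : (4 : ℝ) ^ K ≤ 4 * √T := by
      have hl4 : Real.log 4 ≤ 2 := by
        have : Real.log 4 = 2 * Real.log 2 := by
          rw [show (4 : ℝ) = 2 ^ 2 by norm_num, Real.log_pow]; norm_num
        linarith [Real.log_two_lt_d9]
      rw [← Real.log_le_log_iff (by positivity) (by positivity), Real.log_pow,
        Real.log_mul (by norm_num) hsq.ne', Real.log_sqrt hT0.le]
      have : (0 : ℝ) ≤ Real.log 4 := Real.log_nonneg (by norm_num)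
      nlinarith
    have hlog2 : Real.log T ≤ 2 * √T := by
      have h1 := Real.log_le_sub_one_of_pos hsq
      rw [Real.log_sqrt hT0.le] at h1
      linarith
    obtain ⟨ψ, h1, h2, h3, h5, h6⟩ := h K hK
    refine ⟨ψ, h1, h2, h3, ?_, ?_⟩
    · simp only [Psi, OfNat.ofNat_ne_one, if_false]
      calc Real.log T * ∫ x, ψ x ^ 2 ≤ (2 * √T) * (A * (4 * √T)) := by
            gcongr
            · exact h5.trans (by gcongr)
        _ = 8 * A * (√T * √T) := by ring
        _ ≤ _ := by rw [hTT]; gcongr; linarith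
    · simp only [Psi, OfNat.ofNat_ne_one, if_false]
      have hK0 : (0 : ℝ) < K := by exact_mod_cast hK
      calc Real.log T * ∫ x, ‖fderiv ℝ ψ x‖ ^ 2 ≤ (4 * K) * (G / K) := by
            gcongr
            · linarith
        _ = 4 * G := by field_simp
        _ ≤ _ := by linarith

/-! ### Occupation times near non-equilibria. -/

theorem Psi_nonneg (N : ℕ) {T : ℝ} (hT : 1 ≤ T) : 0 ≤ Psi N T := by
  unfold Psi
  split_ifs
  · exact Real.sqrt_nonneg T
  · exact Real.log_nonneg hT

theorem Psi_le_self (N : ℕ) {T : ℝ} (hT : 1 ≤ T) : Psi N T ≤ T := by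
  unfold Psi
  split_ifs
  · exact Real.sqrt_le_iff.2 ⟨by linarith, by nlinarith⟩
  · linarith [Real.log_le_sub_one_of_pos (by linarith : 0 < T)]

theorem tendsto_Psi_atTop (N : ℕ) : Tendsto (Psi N) atTop atTop := by
  unfold Psi
  split_ifs
  · exact Real.tendsto_sqrt_atTop
  · exact Real.tendsto_log_atTop

/-- The weighted occupation time whose limit superior is `occupation`. -/
noncomputable def occupationUpTo {X : Type*} [TopologicalSpace X] (N : ℕ) (Φ : Flow ℝ≥0 X)
    (u₀ : X) (V : Set X) (T : ℝ) : ℝ≥0∞ :=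
  ENNReal.ofReal (Psi N T / T) *
    ∫⁻ t in Icc (0 : ℝ) T, V.indicator (fun _ => (1 : ℝ≥0∞)) (traj Φ u₀ t)

theorem occupation_lt_top_iff {X : Type*} [TopologicalSpace X] {N : ℕ} {Φ : Flow ℝ≥0 X}
    {u₀ : X} {V : Set X} :
    occupation N Φ u₀ V < ⊤ ↔ ∃ C : ℝ≥0∞, C < ⊤ ∧ ∀ᶠ T in atTop, occupationUpTo N Φ u₀ V T ≤ C := by
  constructor
  · intro h
    obtain ⟨C, h1, h2⟩ := exists_between h
    exact ⟨C, h2, (eventually_lt_of_limsup_lt h1).mono fun T hT => hT.le⟩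
  · rintro ⟨C, h1, h2⟩
    exact (limsup_le_of_le (by isBoundedDefault) h2).trans_lt h1

/-- Chebyshev's inequality on `(2, T]`; the summand `2` pays for the initial interval, where the
time cutoff may be less than one. -/
theorem setLIntegral_indicator_le {s : Set ℝ} {g : ℝ → ℝ} {δ T : ℝ}
    (hδ : 0 < δ) (hg0 : ∀ t, 0 ≤ g t) (hg : IntegrableOn g (Ioi 0))
    (hs : ∀ t ∈ Icc 2 T, t ∈ s → δ ≤ g t) :
    ∫⁻ t in Icc (0 : ℝ) T, s.indicator (fun _ => (1 : ℝ≥0∞)) t ≤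
      ENNReal.ofReal (2 + (∫ t in Ioi 0, g t) / δ) := by
  have hpt : ∀ t ∈ Ioc (0 : ℝ) T, s.indicator (fun _ => (1 : ℝ≥0∞)) t ≤
      (Iic (2 : ℝ)).indicator (fun _ => 1) t + ENNReal.ofReal (g t / δ) := by
    intro t ht
    by_cases h2 : t ≤ 2
    · rw [indicator_of_mem (show t ∈ Iic (2 : ℝ) from h2)]
      exact (indicator_le_self' (fun _ _ => zero_le) t).trans le_self_add
    · by_cases hts : t ∈ s
      · rw [indicator_of_mem hts]
        refine le_add_left ?_
        rw [ENNReal.one_le_ofReal, one_le_div hδ]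
        exact hs t ⟨(not_le.1 h2).le, ht.2⟩ hts
      · rw [indicator_of_notMem hts]; exact zero_le
  calc ∫⁻ t in Icc (0 : ℝ) T, s.indicator (fun _ => (1 : ℝ≥0∞)) t
      = ∫⁻ t in Ioc (0 : ℝ) T, s.indicator (fun _ => (1 : ℝ≥0∞)) t :=
        setLIntegral_congr Ioc_ae_eq_Icc.symm
    _ ≤ ∫⁻ t in Ioc (0 : ℝ) T,
          ((Iic (2 : ℝ)).indicator (fun _ => 1) t + ENNReal.ofReal (g t / δ)) :=
        setLIntegral_mono' measurableSet_Ioc hpt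
    _ = (∫⁻ t in Ioc (0 : ℝ) T, (Iic (2 : ℝ)).indicator (fun _ => 1) t) +
          ∫⁻ t in Ioc (0 : ℝ) T, ENNReal.ofReal (g t / δ) :=
        lintegral_add_left (measurable_const.indicator measurableSet_Iic) _
    _ ≤ ENNReal.ofReal 2 + ENNReal.ofReal ((∫ t in Ioi 0, g t) / δ) := by
        gcongr
        · rw [lintegral_indicator_const measurableSet_Iic, one_mul,
            Measure.restrict_apply measurableSet_Iic]
          calc volume (Iic 2 ∩ Ioc 0 T) ≤ volume (Ioc (0 : ℝ) 2) :=
                measure_mono fun t ht => ⟨ht.2.1, ht.1⟩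
            _ = ENNReal.ofReal 2 := by simp
        · rw [← integral_div, ofReal_integral_eq_lintegral_ofReal (hg.div_const δ)
            (Eventually.of_forall fun t => div_nonneg (hg0 t) hδ.le)]
          exact lintegral_mono_set Ioc_subset_Ioi_self
    _ = _ := (ENNReal.ofReal_add zero_le_two
        (div_nonneg (integral_nonneg hg0) hδ.le)).symm

/-- Every point that is not an equilibrium has an open neighbourhood with finite occupation. -/
theorem exists_isOpen_occupation_lt_top {X : Type*} [TopologicalSpace X] {N : ℕ} (hN : 1 ≤ N)
    (hN' : N ≤ 2) {Φ : Flow ℝ≥0 X} {e : X → C(Space N, ℝ)} {f : X → C(Space N, Space N)}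
    {d : X → C(Space N, ℝ)} (hsys : IsExtendedDissipative N Φ e f d) (hbdd : IsBoundedEnergy e)
    (u₀ : X) {v : X} (hv : v ∉ equilibria Φ) :
    ∃ V : Set X, IsOpen V ∧ v ∈ V ∧ occupation N Φ u₀ V < ⊤ := by
  obtain ⟨E, hE, heE⟩ := hbdd
  obtain ⟨b, hbmono, hb0, hfb⟩ := hsys.flux_bound
  have hB : 0 ≤ b E := hb0 E hE.le
  have hfB : ∀ u x, ‖f u x‖ ^ 2 ≤ b E * d u x := fun u x =>
    (hfb u x).trans (mul_le_mul_of_nonneg_right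
      (hbmono (hsys.e_nonneg u x) hE.le (heE u x)) (hsys.d_nonneg u x))
  obtain ⟨x₀, hx₀⟩ : ∃ x, d v x ≠ 0 := by
    by_contra! h
    exact hv (hsys.equilibrium_of_dissipation_eq_zero v h)
  have hx₀' : 0 < d v x₀ := (hsys.d_nonneg v x₀).lt_of_ne' hx₀
  set c := d v x₀ / 2
  have hc : 0 < c := by positivity
  have hnear : ∀ᶠ x in 𝓝 x₀, d v x ∈ Ioi c :=
    (d v).continuous.continuousAt.eventually_mem (Ioi_mem_nhds (half_lt_self hx₀'))
  obtain ⟨r, hr, hball⟩ := Metric.nhds_basis_closedBall.mem_iff.1 hnear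
  -- The lower bound `c` on a compact ball is an open condition on `d u` in the compact-open
  -- topology, hence on `u`.
  let V : Set X := {u | MapsTo (d u) (Metric.closedBall x₀ r) (Ioi c)}
  have hV : IsOpen V := (ContinuousMap.isOpen_setOfPred_mapsTo (isCompact_closedBall x₀ r)
    isOpen_Ioi).preimage hsys.continuous_d
  refine ⟨V, hV, hball, ?_⟩
  set R := ‖x₀‖ + r
  have hR : 0 < R := by positivity
  have hsub : Metric.closedBall x₀ r ⊆ Metric.closedBall 0 R :=
    Metric.closedBall_subset_closedBall' (by rw [dist_zero_right, add_comm])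
  set δ := c * volume.real (Metric.closedBall x₀ r)
  have hδ : 0 < δ := mul_pos hc (ENNReal.toReal_pos
    (Metric.measure_closedBall_pos volume x₀ hr).ne' measure_closedBall_lt_top.ne)
  obtain ⟨M, hM, htime⟩ := exists_time_cutoff
  obtain ⟨C, hC, hspace⟩ := exists_space_cutoff hN hN' hR
  rw [occupation_lt_top_iff]
  -- `2` covers the initial interval, using `Psi N T ≤ T`; the other terms come from the energy
  -- estimate, with `8 = 4 * 2` because `T + 1 ≤ 2 * T`.
  refine ⟨ENNReal.ofReal (2 + (2 * E * M * C + 8 * b E * C) / δ), ENNReal.ofReal_lt_top, ?_⟩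
  filter_upwards [eventually_ge_atTop 2] with T hT
  obtain ⟨θ, hθ, hθc, hθs, hθ0, hθ1, hθM, hθT⟩ := htime T (by linarith)
  obtain ⟨ψ, hψ, hψc, hψ1, hψA, hψG⟩ := hspace T hT
  obtain ⟨hint, hle⟩ := localized_dissipation_le hsys.continuous_e hsys.continuous_f
    hsys.continuous_d hsys.e_nonneg heE hsys.d_nonneg hfB hB (hsys.energy_balance u₀)
    hψ hψc hθ hθc hθs hθ0
  have hlow : ∀ u ∈ V, δ ≤ ∫ x, ψ x ^ 2 * d u x := by
    intro u hu
    have hi : Integrable fun x => ψ x ^ 2 * d u x := by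
      refine ((hψ.continuous.pow 2).mul (d u).continuous).integrable_of_hasCompactSupport ?_
      refine HasCompactSupport.intro hψc.isCompact fun x hx => ?_
      simp [image_eq_zero_of_notMem_tsupport hx]
    calc δ = ∫ _ in Metric.closedBall x₀ r, c := by
          rw [setIntegral_const, smul_eq_mul, mul_comm]
      _ ≤ ∫ x in Metric.closedBall x₀ r, ψ x ^ 2 * d u x := by
          refine setIntegral_mono_on (integrableOn_const measure_closedBall_lt_top.ne)
            hi.integrableOn measurableSet_closedBall fun x hx => ?_
          rw [hψ1 x (hsub hx), one_pow, one_mul]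
          exact (hu hx).le
      _ ≤ ∫ x, ψ x ^ 2 * d u x := setIntegral_le_integral hi
          (Eventually.of_forall fun x => mul_nonneg (sq_nonneg _) (hsys.d_nonneg u x))
  set g : ℝ → ℝ := fun t => θ t * ∫ x, ψ x ^ 2 * d (traj Φ u₀ t) x with hg
  have hg0 : ∀ t, 0 ≤ g t := fun t => mul_nonneg (hθ0 t)
    (integral_nonneg fun x => mul_nonneg (sq_nonneg _) (hsys.d_nonneg _ x))
  have hocc := setLIntegral_indicator_le (s := traj Φ u₀ ⁻¹' V) (T := T) hδ hg0 hint
    fun t ht htV => by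
      simp only [hg, hθ1 t ht, one_mul]
      exact hlow _ htV
  have hΨ0 : 0 ≤ Psi N T := Psi_nonneg N (by linarith)
  have hT0 : 0 < T := by linarith
  have hΨT : Psi N T ≤ T := Psi_le_self N (by linarith)
  have hA0 : 0 ≤ ∫ x, ψ x ^ 2 := integral_nonneg fun x => sq_nonneg (ψ x)
  have hG0 : 0 ≤ ∫ x, ‖fderiv ℝ ψ x‖ ^ 2 := integral_nonneg fun x => sq_nonneg ‖fderiv ℝ ψ x‖
  have hQ : Psi N T * ∫ t in Ioi 0, g t ≤ (2 * E * M * C + 8 * b E * C) * T := by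
    calc Psi N T * ∫ t in Ioi 0, g t
        ≤ Psi N T * (2 * E * M * (∫ x, ψ x ^ 2) +
            4 * b E * (T + 1) * ∫ x, ‖fderiv ℝ ψ x‖ ^ 2) := by
          refine mul_le_mul_of_nonneg_left (hle.trans ?_) hΨ0
          gcongr
      _ = 2 * E * M * (Psi N T * ∫ x, ψ x ^ 2) +
            4 * b E * (T + 1) * (Psi N T * ∫ x, ‖fderiv ℝ ψ x‖ ^ 2) := by ring
      _ ≤ 2 * E * M * (C * T) + 4 * b E * (T + T) * C := by
          gcongr
          linarith
      _ = _ := by ring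
  calc occupationUpTo N Φ u₀ V T
      ≤ ENNReal.ofReal (Psi N T / T) * ENNReal.ofReal (2 + (∫ t in Ioi 0, g t) / δ) := by
        unfold occupationUpTo
        gcongr
        exact hocc
    _ = ENNReal.ofReal (Psi N T / T * (2 + (∫ t in Ioi 0, g t) / δ)) :=
        (ENNReal.ofReal_mul (by positivity)).symm
    _ ≤ _ := by
        refine ENNReal.ofReal_le_ofReal ?_
        calc Psi N T / T * (2 + (∫ t in Ioi 0, g t) / δ)
            = 2 * (Psi N T / T) + (Psi N T * ∫ t in Ioi 0, g t) / T / δ := by ring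
          _ ≤ 2 * 1 + (2 * E * M * C + 8 * b E * C) / δ := by
              gcongr
              · exact (div_le_one hT0).2 hΨT
              · exact (div_le_iff₀ hT0).2 hQ
          _ = _ := by ring

/-! ### Compactness of the phase space. -/

section Topology

variable {X : Type*} [TopologicalSpace X] {N : ℕ} {Φ : Flow ℝ≥0 X} {u₀ : X}

theorem occupation_mono {V W : Set X} (h : V ⊆ W) : occupation N Φ u₀ V ≤ occupation N Φ u₀ W := by
  refine limsup_le_limsup (Eventually.of_forall fun T => ?_)
  dsimp only
  gcongr

/-- Eventual bounds add up. Openness of one set supplies the measurability needed to split the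
integral; the other set is arbitrary. -/
theorem occupation_union_lt_top {V W : Set X} (hV : IsOpen V) (h1 : occupation N Φ u₀ V < ⊤)
    (h2 : occupation N Φ u₀ W < ⊤) : occupation N Φ u₀ (V ∪ W) < ⊤ := by
  rw [occupation_lt_top_iff] at *
  obtain ⟨C, hC, h1⟩ := h1
  obtain ⟨D, hD, h2⟩ := h2
  refine ⟨C + D, ENNReal.add_lt_top.2 ⟨hC, hD⟩, ?_⟩
  filter_upwards [h1, h2] with T hT1 hT2
  refine le_trans ?_ (add_le_add hT1 hT2)
  have hm : Measurable fun t => V.indicator (fun _ => (1 : ℝ≥0∞)) (traj Φ u₀ t) := by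
    change Measurable ((traj Φ u₀ ⁻¹' V).indicator fun _ => (1 : ℝ≥0∞))
    exact measurable_const.indicator (hV.preimage (continuous_traj Φ u₀)).measurableSet
  unfold occupationUpTo
  rw [← mul_add, ← lintegral_add_left hm]
  gcongr with t
  by_cases h : traj Φ u₀ t ∈ V
  · simp [h]
  · by_cases h' : traj Φ u₀ t ∈ W <;> simp [h, h']

/-- The trajectory spends all of `[0, T]` in the whole space, so the weighted time is `Psi N T`
itself. -/
theorem occupation_univ : occupation N Φ u₀ univ = ⊤ := by
  refine Tendsto.limsup_eq ?_
  have h : Tendsto (fun T => ENNReal.ofReal (Psi N T)) atTop (𝓝 ⊤) :=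
    ENNReal.tendsto_ofReal_atTop.comp (tendsto_Psi_atTop N)
  refine h.congr' ?_
  filter_upwards [eventually_ge_atTop 1] with T hT
  have hT0 : 0 < T := by linarith
  simp only [indicator_univ, lintegral_const, Measure.restrict_apply, MeasurableSet.univ,
    univ_inter, Real.volume_Icc, sub_zero, one_mul]
  rw [← ENNReal.ofReal_mul (div_nonneg (Psi_nonneg N hT) hT0.le), div_mul_cancel₀ _ hT0.ne']

theorem notMem_omegaBar_iff {v : X} :
    v ∉ omegaBar N Φ u₀ ↔ ∃ V : Set X, IsOpen V ∧ v ∈ V ∧ occupation N Φ u₀ V < ⊤ := by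
  constructor
  · intro h
    simp only [omegaBar, mem_ofPred_eq, not_forall] at h
    obtain ⟨V, hV, h⟩ := h
    exact ⟨interior V, isOpen_interior, mem_interior_iff_mem_nhds.2 hV,
      (occupation_mono interior_subset).trans_lt (lt_top_iff_ne_top.2 h)⟩
  · rintro ⟨V, hV, hv, h⟩ hmem
    exact h.ne (hmem V (hV.mem_nhds hv))

theorem isClosed_omegaBar : IsClosed (omegaBar N Φ u₀) := by
  rw [← isOpen_compl_iff, isOpen_iff_mem_nhds]
  intro v hv
  obtain ⟨V, hV, hvV, h⟩ := notMem_omegaBar_iff.1 hv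
  filter_upwards [hV.mem_nhds hvV] with w hw
  exact notMem_omegaBar_iff.2 ⟨V, hV, hw, h⟩

theorem occupation_lt_top_of_isCompact {K : Set X} (hK : IsCompact K)
    (hd : ∀ v ∈ K, v ∉ omegaBar N Φ u₀) : occupation N Φ u₀ K < ⊤ := by
  -- The induction carries an open superset, since additivity of the occupation bounds needs a
  -- measurable set.
  have h : ∃ V : Set X, IsOpen V ∧ K ⊆ V ∧ occupation N Φ u₀ V < ⊤ := by
    refine hK.induction_on (p := fun K => ∃ V : Set X, IsOpen V ∧ K ⊆ V ∧
      occupation N Φ u₀ V < ⊤) ?_ ?_ ?_ ?_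
    · exact ⟨∅, isOpen_empty, subset_rfl, by simp [occupation]⟩
    · rintro s t hst ⟨V, hV, htV, h⟩
      exact ⟨V, hV, hst.trans htV, h⟩
    · rintro s t ⟨V, hV, hsV, h⟩ ⟨W, hW, htW, h'⟩
      exact ⟨V ∪ W, hV.union hW, union_subset_union hsV htW, occupation_union_lt_top hV h h'⟩
    · intro v hv
      obtain ⟨V, hV, hvV, h⟩ := notMem_omegaBar_iff.1 (hd v hv)
      exact ⟨V, mem_nhdsWithin_of_mem_nhds (hV.mem_nhds hvV), V, hV, subset_rfl, h⟩
  obtain ⟨V, -, hKV, h⟩ := h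
  exact (occupation_mono hKV).trans_lt h

end Topology

end ExtDiss

theorem proposition5p3 {X : Type*} [TopologicalSpace X] [TopologicalSpace.MetrizableSpace X]
    [CompactSpace X] (N : ℕ) (hN : 1 ≤ N) (hN' : N ≤ 2) (Φ : Flow ℝ≥0 X)
    (e : X → C(ExtDiss.Space N, ℝ)) (f : X → C(ExtDiss.Space N, ExtDiss.Space N))
    (d : X → C(ExtDiss.Space N, ℝ)) (hsys : ExtDiss.IsExtendedDissipative N Φ e f d)
    (hbdd : ExtDiss.IsBoundedEnergy e) (u₀ : X) :
    (ExtDiss.omegaBar N Φ u₀).Nonempty ∧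
    IsCompact (ExtDiss.omegaBar N Φ u₀) ∧
    ExtDiss.omegaBar N Φ u₀ ⊆ ExtDiss.equilibria Φ ∧
    ∀ V ∈ 𝓝ˢ (ExtDiss.omegaBar N Φ u₀), ExtDiss.occupation N Φ u₀ Vᶜ < ⊤ := by
  refine ⟨?_, ExtDiss.isClosed_omegaBar.isCompact, ?_, ?_⟩
  · by_contra h
    rw [not_nonempty_iff_eq_empty] at h
    -- Were `omegaBar` empty, the compact space itself would have finite occupation.
    have := ExtDiss.occupation_lt_top_of_isCompact (N := N) (Φ := Φ) (u₀ := u₀) isCompact_univ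
      (by simp [h])
    exact this.ne ExtDiss.occupation_univ
  · intro v hv
    by_contra h
    exact ExtDiss.notMem_omegaBar_iff.2
      (ExtDiss.exists_isOpen_occupation_lt_top hN hN' hsys hbdd u₀ h) hv
  · intro V hV
    have hsub := subset_interior_iff_mem_nhdsSet.2 hV
    -- Passing to the interior of `V` makes the complement closed, hence compact, and it still
    -- avoids `omegaBar`.
    refine (ExtDiss.occupation_mono (compl_subset_compl.2 interior_subset)).trans_lt
      (ExtDiss.occupation_lt_top_of_isCompact
        isOpen_interior.isClosed_compl.isCompact fun v hv hmem => hv (hsub hmem))
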